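/- **Notation.** Let $\mathcal X,\mathcal Y,\mathcal Z$ be finite nonempty sets. For $n\ge 0$ and $k\ge 1$ let $$C^n_k=\sum_{s\in\{1,\dots,k\}^n} P\big(s\mid\hat\theta(s)\big),\qquad P\big(s\mid\hat\theta(s)\big)=\prod_{j=1}^k\Big(\frac{|j|_s}{n}\Big)^{|j|_s},$$ be the normalizing constant of the multinomial normalized maximum likelihood distribution, where $|j|_s$ is the number of occurrences of $j$ in $s$ (with $0^0=1$ and $C^0_k=1$). For variables $X$, $Z$ with domains $\mathcal X$, $\mathcal Z$ and sample size $n$, the quotient NML (qNML) regret is $$\mathcal R_q(X\mid Z)=\log\frac{C^n_{|\mathcal X|\,|\mathcal Z|}}{C^n_{|\mathcal Z|}},$$ and in $\mathcal R_q(X\mid Z,Y)$ the conditioning variable $(Z,Y)$ has domain $\mathcal Z\times\mathcal Y$. For samples $x^n\in\mathcal X^n$, $z^n\in\mathcal Z^n$ put $$S_q(x^n\mid z^n)=\sum_{v\in\mathcal Z}|v|\,\hat H(x^n\mid z^n=v)+\mathcal R_q(X\mid Z),$$ where $|v|$ is the frequency of $v$ in $z^n$ and $\hat H(x^n\mid z^n=v)$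 is the entropy of the empirical distribution of the $x_i$ over those $i$ with $z_i=v$; further let $$SCI_q(x^n;y^n\mid z^n)=S_q(x^n\mid z^n)-S_q(x^n\mid (z,y)^n).$$ Conditional mutual information is $I(X;Y\mid Z)=H(X\mid Z)-H(X\mid Z,Y)$ with Shannon entropies, and $X$, $Y$ are conditionally independent given $Z$ if $I(X;Y\mid Z)=0$. All logarithms are natural. **Theorem.** 1. For every sample size $n$, $\mathcal R_q(X\mid Z)\le\mathcal R_q(X\mid Z,Y)$. 2. For every sample $(x^n,y^n,z^n)$ of size $n$: if $X$ and $Y$ are conditionally independent given $Z$ under the empirical distribution of the sample, then $SCI_q(x^n;y^n\mid z^n)\le 0$. 3. Let $X,Y,Z$ be random variables with values in $\mathcal X,\mathcal Y,\mathcal Z$, and let $SCI_q^n$ be $SCI_q$ evaluated on the first $n$ terms of an i.i.d. sequence of observations with the law of $(X,Y,Z)$. Then $SCI_q^n$ is square integrable for every $n$, and (a) $\frac1n SCI_q^n$ is an asymptotically unbiased estimator of conditional mutual information: $\lim_{n\to\infty}\mathbb E\big[\tfrac1n SCI_q^n\big]=I(X;Y\mid Z)$; (b) $\frac1n SCI_q^n$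 is an $L_2$ consistent estimator of conditional mutual information: $\lim_{n\to\infty}\mathbb E\big[\big(\tfrac1n SCI_q^n-I(X;Y\mid Z)\big)^2\big]=0$. -/

import Mathlib

open MeasureTheory ProbabilityTheory Filter Topology

namespace QNML

/-- `count s a` is the frequency `|a|` of the value `a` in the sample `s = (s₁, …, sₙ)`. -/
noncomputable def count {n : ℕ} {α : Type*} (s : Fin n → α) (a : α) : ℕ :=
  Nat.card {i : Fin n // s i = a}

/-- The empirical distribution `a ↦ |a| / n` of the sample `s`. It is the maximum likelihood
estimator for the multinomial model, see `likelihood_le_empDist`. -/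
noncomputable def empDist {n : ℕ} {α : Type*} (s : Fin n → α) (a : α) : ℝ :=
  (count s a : ℝ) / n

/-- The likelihood of the i.i.d. sample `s` under the probability vector `θ`. -/
noncomputable def likelihood {n : ℕ} {α : Type*} (θ : α → ℝ) (s : Fin n → α) : ℝ :=
  ∏ i, θ (s i)

/-- The empirical distribution maximizes the likelihood over all probability vectors. -/
theorem likelihood_le_empDist {n : ℕ} {α : Type*} [Fintype α] (s : Fin n → α) (θ : α → ℝ)
    (hθ : θ ∈ stdSimplex ℝ α) : likelihood θ s ≤ likelihood (empDist s) s := by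
  classical
  have hc : ∀ a, count s a = (Finset.univ.filter (fun i => s i = a)).card := fun a => by
    rw [count, Nat.card_eq_fintype_card, Fintype.card_subtype]
  have hpos : ∀ i, 0 < (count s (s i) : ℝ) := fun i => by
    rw [hc, Nat.cast_pos, Finset.card_pos]
    exact ⟨i, by simp⟩
  have hn : ∀ _ : Fin n, (0 : ℝ) < n := fun i => by
    exact_mod_cast Nat.lt_of_le_of_lt (Nat.zero_le _) i.2
  have hp : ∀ i, 0 < empDist s (s i) := fun i => div_pos (hpos i) (hn i)
  have hsum : ∑ i, θ (s i) / empDist s (s i) ≤ n := by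
    have h1 : ∑ i, θ (s i) / empDist s (s i)
        = ∑ a, ∑ i with s i = a, θ (s i) / empDist s (s i) :=
      (Finset.sum_fiberwise _ _ _).symm
    rw [h1]
    calc _ ≤ ∑ a, θ a * n := by
          refine Finset.sum_le_sum fun a _ => ?_
          have h2 : ∑ i with s i = a, θ (s i) / empDist s (s i)
              = (count s a : ℝ) * (θ a / empDist s a) := by
            rw [hc, ← nsmul_eq_mul, ← Finset.sum_const]
            refine Finset.sum_congr rfl fun i hi => ?_
            rw [(Finset.mem_filter.mp hi).2]
          rw [h2]
          by_cases h0 : (count s a : ℝ) = 0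
          · rw [h0, zero_mul]
            exact mul_nonneg (hθ.1 a) (Nat.cast_nonneg n)
          · apply le_of_eq
            rw [empDist]
            field_simp
      _ = n := by rw [← Finset.sum_mul, hθ.2, one_mul]
  have hfac : likelihood θ s
      = likelihood (empDist s) s * ∏ i, θ (s i) / empDist s (s i) := by
    rw [likelihood, likelihood, ← Finset.prod_mul_distrib]
    exact Finset.prod_congr rfl fun i _ => (mul_div_cancel₀ _ (hp i).ne').symm
  have hle : ∏ i, θ (s i) / empDist s (s i) ≤ 1 := by
    calc _ ≤ ∏ i, Real.exp (θ (s i) / empDist s (s i) - 1) := by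
          refine Finset.prod_le_prod (fun i _ => div_nonneg (hθ.1 _) (hp i).le) fun i _ => ?_
          have := Real.add_one_le_exp (θ (s i) / empDist s (s i) - 1)
          linarith
      _ = Real.exp (∑ i, (θ (s i) / empDist s (s i) - 1)) := (Real.exp_sum _ _).symm
      _ ≤ 1 := by
          rw [Real.exp_le_one_iff]
          simp only [Finset.sum_sub_distrib, Finset.sum_const, Finset.card_univ, Fintype.card_fin,
            nsmul_eq_mul, mul_one]
          linarith
  rw [hfac]
  exact mul_le_of_le_one_right (Finset.prod_nonneg fun i _ => (hp i).le) hle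

/-- The multinomial NML normalizing constant `C^n_k`: the sum over all samples of size `n` from a
domain with `k` values of the maximized likelihood of the sample. -/
noncomputable def nmlC (n k : ℕ) : ℝ :=
  ∑ s : Fin n → Fin k, likelihood (empDist s) s

/-- The quotient NML regret `R_q(X | Z) = log (C^n_{|X||Z|} / C^n_{|Z|})` of a variable with
domain `X` given a variable with domain `Z`. -/
noncomputable def regretQ (n : ℕ) (X Z : Type*) [Fintype X] [Fintype Z] : ℝ :=
  Real.log (nmlC n (Fintype.card X * Fintype.card Z) / nmlC n (Fintype.card Z))

/-- Shannon entropy (natural logarithm, `0 log 0 = 0`) of a distribution on a finite set. -/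
noncomputable def entropy {α : Type*} [Fintype α] (p : α → ℝ) : ℝ :=
  ∑ a, Real.negMulLog (p a)

/-- The second marginal of a joint distribution. -/
noncomputable def sndMarginal {α β : Type*} [Fintype α] (p : α × β → ℝ) (b : β) : ℝ :=
  ∑ a, p (a, b)

/-- The conditional distribution of the first coordinate, given that the second one is `b`
(zero if `b` has probability zero). -/
noncomputable def condDist {α β : Type*} [Fintype α] (p : α × β → ℝ) (b : β) (a : α) : ℝ :=
  p (a, b) / sndMarginal p b

/-- The conditional entropy `H(first coordinate | second coordinate)` under `p`. -/
noncomputable def condEntropy {α β : Type*} [Fintype α] [Fintype β] (p : α × β → ℝ) : ℝ :=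
  ∑ b, sndMarginal p b * entropy (condDist p b)

/-- The conditional mutual information `I(X ; Y | Z) = H(X | Z) - H(X | Z, Y)` of the three
coordinates `(x, y, z)` under the joint distribution `p`. -/
noncomputable def cmi {X Y Z : Type*} [Fintype X] [Fintype Y] [Fintype Z]
    (p : X × Y × Z → ℝ) : ℝ :=
  condEntropy (fun w : X × Z => ∑ y, p (w.1, y, w.2)) -
    condEntropy (fun w : X × (Z × Y) => p (w.1, w.2.2, w.2.1))

/-- `X` and `Y` are statistically independent given `Z` under `p`. -/
def CondIndep {X Y Z : Type*} [Fintype X] [Fintype Y] [Fintype Z] (p : X × Y × Z → ℝ) : Prop :=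
  cmi p = 0

/-- Conditional stochastic complexity under quotient NML,
`S_q(xⁿ | yⁿ) = ∑_v |v| Ĥ(xⁿ | yⁿ = v) + log (C^n_{|X||Y|} / C^n_{|Y|})`. -/
noncomputable def stochQ {n : ℕ} {X Y : Type*} [Fintype X] [Fintype Y]
    (x : Fin n → X) (y : Fin n → Y) : ℝ :=
  ∑ v : Y, (count y v : ℝ) * entropy (condDist (empDist fun i => (x i, y i)) v) + regretQ n X Y

/-- `SCI_q(X ; Y | Z) = S_q(X | Z) - S_q(X | Z, Y)`, computed on a sample of size `n`. -/
noncomputable def sciQ {n : ℕ} {X Y Z : Type*} [Fintype X] [Fintype Y] [Fintype Z]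
    (x : Fin n → X) (y : Fin n → Y) (z : Fin n → Z) : ℝ :=
  stochQ x z - stochQ x (fun i => (z i, y i))

/-- The law of a random variable with values in a finite set, as a mass function. -/
noncomputable def law {Ω α : Type*} [MeasurableSpace Ω] (P : Measure Ω) (W : Ω → α) (a : α) : ℝ :=
  P.real (W ⁻¹' {a})

/-- `SCI_q` of the first `n` members of a random sequence of observations of `(X, Y, Z)`. -/
noncomputable def sampleSciQ {Ω X Y Z : Type*} [Fintype X] [Fintype Y] [Fintype Z]
    (W : ℕ → Ω → X × Y × Z) (n : ℕ) (ω : Ω) : ℝ :=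
  sciQ (fun i : Fin n => (W i ω).1) (fun i : Fin n => (W i ω).2.1) (fun i : Fin n => (W i ω).2.2)

end QNML

namespace QNML

/-! Multiplied by `n ^ n`, the maximized likelihood of `s` is `∏ i, |s i|`, the number of self-maps
`f` of the index set with `s ∘ f = s`. Exchanging the sums over `s` and `f` gives `n ^ n * C^n_k = ∑
f, k ^ c(f)`, where `c(f)` counts the components of `f`. A sum of powers of `k` is log-convex in
`log k`, so `C^n_{km} / C^n_m` is nondecreasing in `m`; this is the monotonicity of the regret
(`nmlC_mul_nmlC_le`).

By `sciQ_eq`, SCI is `n` times the empirical conditional mutual information plus a nonpositive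
difference of regrets, which settles the independent case. That difference is `o(n)`, since `C^n_k`
grows at most polynomially in `n`. The strong law, continuity of mutual information and dominated
convergence then give both limits. -/

/-! ### The normalizing constant as a sum over self-maps -/

open Classical in
theorem count_eq_sum {n : ℕ} {α : Type*} (s : Fin n → α) (a : α) :
    (count s a : ℝ) = ∑ i, if s i = a then (1 : ℝ) else 0 := by
  rw [count, Nat.card_eq_fintype_card, Fintype.card_subtype, Finset.sum_boole]

theorem likelihood_empDist {n : ℕ} {α : Type*} (s : Fin n → α) :
    (n : ℝ) ^ n * likelihood (empDist s) s = ∏ i, (count s (s i) : ℝ) := by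
  rcases Nat.eq_zero_or_pos n with rfl | hn
  · simp [likelihood]
  · have h : (n : ℝ) ≠ 0 := by positivity
    simp only [likelihood, empDist, Finset.prod_div_distrib, Finset.prod_const, Finset.card_univ,
      Fintype.card_fin]
    field_simp

/-- The number of connected components of the functional graph of `f`. -/
noncomputable def numComponents {n : ℕ} (f : Fin n → Fin n) : ℕ :=
  Nat.card (Quot fun i j => f i = j)

/-- Invariance under `f` means being constant on components, so each component is coloured freely.
-/
theorem card_comp_eq_self {n k : ℕ} (f : Fin n → Fin n) :
    Nat.card {s : Fin n → Fin k // ∀ i, s (f i) = s i} = k ^ numComponents f := by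
  let e : {s : Fin n → Fin k // ∀ i, s (f i) = s i} ≃ ((Quot fun i j => f i = j) → Fin k) :=
    { toFun := fun s => Quot.lift s.1 fun i j h => by rw [← h, s.2]
      invFun := fun t => ⟨fun i => t (Quot.mk _ i), fun i => by
        exact congrArg t (Quot.sound (r := fun i j => f i = j) rfl).symm⟩
      left_inv := fun s => rfl
      right_inv := fun t => by
        ext q
        induction q using Quot.ind
        rfl }
  rw [Nat.card_congr e, Nat.card_fun, Nat.card_fin, numComponents]

/-- Up to the factor `n ^ n`, the normalizing constant is the generating polynomial of the number
of components of self-maps of an `n`-element set. -/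
theorem pow_mul_nmlC (n k : ℕ) :
    (n : ℝ) ^ n * nmlC n k = ∑ f : Fin n → Fin n, (k : ℝ) ^ numComponents f := by
  classical
  rw [nmlC, Finset.mul_sum]
  have h1 (s : Fin n → Fin k) : (n : ℝ) ^ n * likelihood (empDist s) s
      = ∑ f : Fin n → Fin n, if ∀ i, s (f i) = s i then (1 : ℝ) else 0 := by
    rw [likelihood_empDist]
    simp only [count_eq_sum]
    -- Expanding `∏ i, ∑ j, 1[s j = s i]` amounts to choosing an index `j = f i` for each `i`.
    rw [Finset.prod_univ_sum, Fintype.piFinset_univ]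
    refine Finset.sum_congr rfl fun f _ => ?_
    split_ifs with h
    · exact Finset.prod_eq_one fun i _ => if_pos (h i)
    · obtain ⟨i, hi⟩ := not_forall.1 h
      exact Finset.prod_eq_zero (Finset.mem_univ i) (if_neg hi)
  simp only [h1]
  rw [Finset.sum_comm]
  refine Finset.sum_congr rfl fun f _ => ?_
  rw [Finset.sum_boole, ← Fintype.card_subtype, ← Nat.card_eq_fintype_card, card_comp_eq_self]
  push_cast
  rfl

theorem one_le_nmlC (n : ℕ) {k : ℕ} (hk : 1 ≤ k) : 1 ≤ nmlC n k := by
  have hn : (0 : ℝ) < (n : ℝ) ^ n := by exact_mod_cast Nat.pow_self_pos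
  refine le_of_mul_le_mul_left ?_ hn
  rw [pow_mul_nmlC]
  calc (n : ℝ) ^ n * 1 = ∑ _f : Fin n → Fin n, (1 : ℝ) := by simp
    _ ≤ _ := Finset.sum_le_sum fun f _ => one_le_pow₀ (by exact_mod_cast hk)

/-! ### Log-convexity and monotonicity of the regret -/

/-- The product is symmetric in `a` and `b`; for `b ≤ a` both factors are nonnegative. -/
theorem pow_mul_pow_sub_nonneg {k m l : ℝ} (hk : 1 ≤ k) (hm : 0 ≤ m) (hml : m ≤ l) (a b : ℕ) :
    0 ≤ (k ^ a - k ^ b) * (l ^ a * m ^ b - m ^ a * l ^ b) := by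
  wlog h : b ≤ a generalizing a b
  · have := this b a (by omega)
    linarith
  obtain ⟨c, rfl⟩ := Nat.exists_eq_add_of_le h
  refine mul_nonneg (sub_nonneg.2 (pow_le_pow_right₀ hk h)) ?_
  have h1 : l ^ (b + c) * m ^ b - m ^ (b + c) * l ^ b = (l * m) ^ b * (l ^ c - m ^ c) := by ring
  rw [h1]
  have : m ^ c ≤ l ^ c := pow_le_pow_left₀ hm hml c
  have h0 : 0 ≤ l := hm.trans hml
  exact mul_nonneg (by positivity) (sub_nonneg.2 this)

/-- A sum of powers `∑ x ^ a i` is log-convex in `log x`. -/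
theorem sum_pow_mul_sum_pow_le {ι : Type*} [Fintype ι] (a : ι → ℕ) {k m l : ℝ} (hk : 1 ≤ k)
    (hm : 0 ≤ m) (hml : m ≤ l) :
    (∑ i, (k * m) ^ a i) * ∑ i, l ^ a i ≤ (∑ i, (k * l) ^ a i) * ∑ i, m ^ a i := by
  -- Chebyshev's symmetrization: this double sum is twice the difference of the two sides.
  have h : 0 ≤ ∑ i, ∑ j, (k ^ a i - k ^ a j) * (l ^ a i * m ^ a j - m ^ a i * l ^ a j) :=
    Finset.sum_nonneg fun i _ => Finset.sum_nonneg fun j _ => pow_mul_pow_sub_nonneg hk hm hml _ _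
  have h2 : ∑ i, ∑ j, (k ^ a i - k ^ a j) * (l ^ a i * m ^ a j - m ^ a i * l ^ a j)
      = ∑ i, ∑ j, ((k * l) ^ a i * m ^ a j - (k * m) ^ a i * l ^ a j)
        + ∑ i, ∑ j, ((k * l) ^ a j * m ^ a i - (k * m) ^ a j * l ^ a i) := by
    simp only [← Finset.sum_add_distrib]
    refine Finset.sum_congr rfl fun i _ => Finset.sum_congr rfl fun j _ => ?_
    simp only [mul_pow]
    ring
  rw [h2, Finset.sum_comm (f := fun i j => (k * l) ^ a j * m ^ a i - (k * m) ^ a j * l ^ a i)] at h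
  simp only [Finset.sum_sub_distrib, ← Finset.mul_sum, ← Finset.sum_mul] at h
  linarith

theorem nmlC_mul_nmlC_le (n : ℕ) {k m l : ℕ} (hk : 1 ≤ k) (hml : m ≤ l) :
    nmlC n (k * m) * nmlC n l ≤ nmlC n (k * l) * nmlC n m := by
  have hn : (0 : ℝ) < (n : ℝ) ^ n := by exact_mod_cast Nat.pow_self_pos
  refine le_of_mul_le_mul_left ?_ (mul_pos hn hn)
  rw [mul_mul_mul_comm, mul_mul_mul_comm _ _ (nmlC n (k * l))]
  simp only [pow_mul_nmlC, Nat.cast_mul]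
  exact sum_pow_mul_sum_pow_le _ (by exact_mod_cast hk) (by positivity) (by exact_mod_cast hml)

theorem regretQ_le_regretQ_prod (n : ℕ) (X Y Z : Type*) [Fintype X] [Fintype Y] [Fintype Z]
    [Nonempty X] [Nonempty Y] [Nonempty Z] : regretQ n X Z ≤ regretQ n X (Z × Y) := by
  have hX : 1 ≤ Fintype.card X := Fintype.card_pos
  have hY : 1 ≤ Fintype.card Y := Fintype.card_pos
  have hZ : 1 ≤ Fintype.card Z := Fintype.card_pos
  have pos {k : ℕ} (hk : 1 ≤ k) : 0 < nmlC n k := one_pos.trans_le (one_le_nmlC n hk)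
  have hZY : 1 ≤ Fintype.card (Z × Y) := Fintype.card_pos
  refine Real.log_le_log (div_pos (pos (Nat.mul_pos hX hZ)) (pos hZ)) ?_
  rw [div_le_div_iff₀ (pos hZ) (pos hZY)]
  exact nmlC_mul_nmlC_le n hX (by rw [Fintype.card_prod]; exact Nat.le_mul_of_pos_right _ hY)

/-! ### Polynomial growth of the normalizing constant -/

theorem sum_likelihood {α : Type*} [Fintype α] (n : ℕ) (θ : α → ℝ) :
    ∑ s : Fin n → α, likelihood θ s = (∑ a, θ a) ^ n := by
  classical
  simp only [likelihood]
  rw [← Fintype.piFinset_univ, ← Finset.prod_univ_sum]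
  simp

theorem count_le {n : ℕ} {α : Type*} (s : Fin n → α) (a : α) : count s a ≤ n := by
  simpa [count] using Nat.card_le_card_of_injective
    (Subtype.val : {i : Fin n // s i = a} → Fin n) Subtype.val_injective

theorem sum_count {n : ℕ} {α : Type*} [Fintype α] (s : Fin n → α) :
    ∑ a, (count s a : ℝ) = n := by
  classical
  simp only [count_eq_sum]
  rw [Finset.sum_comm]
  simp

/-- There are at most `(n + 1) ^ k` empirical distributions, and each contributes at most `1`. -/
theorem nmlC_le (n k : ℕ) : nmlC n k ≤ ((n : ℝ) + 1) ^ k := by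
  classical
  let θ : (Fin k → ℕ) → Fin k → ℝ := fun c a => (c a : ℝ) / n
  let T : Finset (Fin k → ℕ) := Finset.univ.image fun s : Fin n → Fin k => fun a => count s a
  have hcard : (T.card : ℝ) ≤ ((n : ℝ) + 1) ^ k := by
    have : T ⊆ Fintype.piFinset fun _ : Fin k => Finset.range (n + 1) := by
      intro c hc
      obtain ⟨s, -, rfl⟩ := Finset.mem_image.1 hc
      exact Fintype.mem_piFinset.2 fun a => Finset.mem_range_succ_iff.2 (count_le s a)
    have := Finset.card_le_card this
    rw [Fintype.card_piFinset_const, Finset.card_range] at this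
    exact_mod_cast this
  have hlik (c : Fin k → ℕ) (s : Fin n → Fin k) : 0 ≤ likelihood (θ c) s :=
    Finset.prod_nonneg fun i _ => by positivity
  -- The parameter fitted to `s` is one of those indexed by `T`, so summing over all of `T` only
  -- enlarges the term.
  calc nmlC n k ≤ ∑ s : Fin n → Fin k, ∑ c ∈ T, likelihood (θ c) s :=
        Finset.sum_le_sum fun s _ => Finset.single_le_sum
          (f := fun c => likelihood (θ c) s) (fun c _ => hlik c s)
          (Finset.mem_image_of_mem (fun s a => count s a) (Finset.mem_univ s))
    _ = ∑ c ∈ T, ∑ s : Fin n → Fin k, likelihood (θ c) s := Finset.sum_comm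
    _ ≤ ∑ c ∈ T, 1 := by
        refine Finset.sum_le_sum fun c hc => ?_
        obtain ⟨s, -, rfl⟩ := Finset.mem_image.1 hc
        rw [sum_likelihood]
        refine pow_le_one₀ (Finset.sum_nonneg fun a _ => by positivity) ?_
        simp only [θ]
        rw [← Finset.sum_div, sum_count]
        exact div_self_le_one _
    _ ≤ _ := by simpa using hcard

theorem tendsto_log_nmlC_div (k : ℕ) (hk : 1 ≤ k) :
    Tendsto (fun n : ℕ => Real.log (nmlC n k) / n) atTop (𝓝 0) := by
  have h1 : Tendsto (fun n : ℕ => Real.log ((n : ℝ) + 1) / n) atTop (𝓝 0) := by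
    have hl : (fun x : ℝ => Real.log (x + 1)) =o[atTop] fun x : ℝ => x := by
      have h := Real.isLittleO_log_id_atTop.comp_tendsto (tendsto_atTop_add_const_right _ (1 : ℝ) tendsto_id)
      refine h.trans_isBigO (Asymptotics.IsBigO.of_bound 2 ?_)
      filter_upwards [eventually_ge_atTop (1 : ℝ)] with x hx
      simp only [Function.comp_apply, id_eq, Real.norm_eq_abs]
      rw [abs_of_pos (by linarith), abs_of_pos (by linarith)]
      linarith
    exact hl.tendsto_div_nhds_zero.comp tendsto_natCast_atTop_atTop
  refine squeeze_zero (fun n => div_nonneg (Real.log_nonneg (one_le_nmlC n hk)) n.cast_nonneg)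
    (fun n => ?_) (by simpa using h1.const_mul (k : ℝ))
  rw [← mul_div_assoc]
  refine div_le_div_of_nonneg_right ?_ n.cast_nonneg
  rw [← Real.log_pow]
  exact Real.log_le_log (one_pos.trans_le (one_le_nmlC n hk)) (nmlC_le n k)

theorem tendsto_regretQ_div (X Z : Type*) [Fintype X] [Fintype Z] [Nonempty X] [Nonempty Z] :
    Tendsto (fun n : ℕ => regretQ n X Z / n) atTop (𝓝 0) := by
  have hX : 1 ≤ Fintype.card X := Fintype.card_pos
  have hZ : 1 ≤ Fintype.card Z := Fintype.card_pos
  have h := (tendsto_log_nmlC_div _ (Nat.mul_pos hX hZ)).sub (tendsto_log_nmlC_div _ hZ)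
  rw [sub_zero] at h
  refine h.congr fun n => ?_
  rw [regretQ, Real.log_div (one_pos.trans_le (one_le_nmlC n (Nat.mul_pos hX hZ))).ne'
    (one_pos.trans_le (one_le_nmlC n hZ)).ne', sub_div]

theorem empDist_nonneg {n : ℕ} {α : Type*} (s : Fin n → α) (a : α) : 0 ≤ empDist s a := by
  unfold empDist
  positivity

theorem empDist_le_one {n : ℕ} {α : Type*} (s : Fin n → α) (a : α) : empDist s a ≤ 1 :=
  div_le_one_of_le₀ (by exact_mod_cast count_le s a) n.cast_nonneg

theorem sndMarginal_empDist {n : ℕ} {α β : Type*} [Fintype α] (x : Fin n → α) (y : Fin n → β)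
    (b : β) : sndMarginal (empDist fun i => (x i, y i)) b = empDist y b := by
  classical
  simp only [sndMarginal, empDist, count_eq_sum]
  rw [← Finset.sum_div, Finset.sum_comm]
  congr 1
  refine Finset.sum_congr rfl fun i _ => ?_
  by_cases h : y i = b <;> simp [h]

theorem sum_empDist_triple {n : ℕ} {X Y Z : Type*} [Fintype Y] (x : Fin n → X) (y : Fin n → Y)
    (z : Fin n → Z) (a : X) (c : Z) :
    ∑ b, empDist (fun i => (x i, y i, z i)) (a, b, c) = empDist (fun i => (x i, z i)) (a, c) := by
  classical
  simp only [empDist, count_eq_sum]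
  rw [← Finset.sum_div, Finset.sum_comm]
  congr 1
  refine Finset.sum_congr rfl fun i _ => ?_
  by_cases h : x i = a <;> by_cases h' : z i = c <;> simp [h, h']

theorem empDist_triple_swap {n : ℕ} {X Y Z : Type*} (x : Fin n → X) (y : Fin n → Y)
    (z : Fin n → Z) (a : X) (b : Y) (c : Z) :
    empDist (fun i => (x i, y i, z i)) (a, b, c) =
      empDist (fun i => (x i, (z i, y i))) (a, (c, b)) := by
  simp only [empDist, count, Prod.mk.injEq, and_comm (a := y _ = b)]

theorem stochQ_eq {n : ℕ} {X Y : Type*} [Fintype X] [Fintype Y] (x : Fin n → X) (y : Fin n → Y) :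
    stochQ x y = n * condEntropy (empDist fun i => (x i, y i)) + regretQ n X Y := by
  rw [stochQ, condEntropy, Finset.mul_sum]
  congr 1
  refine Finset.sum_congr rfl fun v _ => ?_
  rw [sndMarginal_empDist, ← mul_assoc]
  congr 1
  rcases Nat.eq_zero_or_pos n with rfl | hn
  · simpa using count_le y v
  · rw [empDist]
    field_simp

theorem sciQ_eq {n : ℕ} {X Y Z : Type*} [Fintype X] [Fintype Y] [Fintype Z]
    (x : Fin n → X) (y : Fin n → Y) (z : Fin n → Z) :
    sciQ x y z = n * cmi (empDist fun i => (x i, y i, z i)) +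
      (regretQ n X Z - regretQ n X (Z × Y)) := by
  have h1 : (fun w : X × Z => ∑ b, empDist (fun i => (x i, y i, z i)) (w.1, b, w.2))
      = empDist fun i => (x i, z i) := funext fun w => sum_empDist_triple x y z w.1 w.2
  have h2 : (fun w : X × (Z × Y) => empDist (fun i => (x i, y i, z i)) (w.1, w.2.2, w.2.1))
      = empDist fun i => (x i, (z i, y i)) :=
    funext fun w => empDist_triple_swap x y z w.1 w.2.2 w.2.1
  rw [sciQ, stochQ_eq, stochQ_eq, cmi, h1, h2]
  ring

/-- The chain rule for entropy. -/
theorem condEntropy_eq {α β : Type*} [Fintype α] [Fintype β] {p : α × β → ℝ} (hp : ∀ w, 0 ≤ p w) :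
    condEntropy p = ∑ b, (∑ a, Real.negMulLog (p (a, b)) - Real.negMulLog (∑ a, p (a, b))) := by
  rw [condEntropy]
  refine Finset.sum_congr rfl fun b _ => ?_
  simp only [entropy, condDist]
  rw [sndMarginal]
  set m := ∑ a, p (a, b) with hm
  rcases eq_or_ne m 0 with h | h
  · have h0 : ∀ a, p (a, b) = 0 := fun a =>
      (Finset.sum_eq_zero_iff_of_nonneg fun a _ => hp (a, b)).1 (hm.symm.trans h) a
        (Finset.mem_univ a)
    simp [h, h0]
  · have hterm (a : α) : m * Real.negMulLog (p (a, b) / m)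
        = Real.negMulLog (p (a, b)) + p (a, b) * Real.log m := by
      rw [div_eq_mul_inv, Real.negMulLog_mul]
      simp only [Real.negMulLog, Real.log_inv]
      field_simp
    rw [Finset.mul_sum]
    simp only [hterm]
    rw [Finset.sum_add_distrib, ← Finset.sum_mul, ← hm, Real.negMulLog]
    ring

theorem exists_continuous_eq_cmi (X Y Z : Type*) [Fintype X] [Fintype Y] [Fintype Z] :
    ∃ g : (X × Y × Z → ℝ) → ℝ, Continuous g ∧ ∀ p, (∀ w, 0 ≤ p w) → cmi p = g p := by
  refine ⟨fun p =>
    (∑ b : Z, (∑ a : X, Real.negMulLog (∑ y, p (a, y, b))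
      - Real.negMulLog (∑ a : X, ∑ y, p (a, y, b)))) -
    ∑ b : Z × Y, (∑ a : X, Real.negMulLog (p (a, b.2, b.1))
      - Real.negMulLog (∑ a : X, p (a, b.2, b.1))), ?_, fun p hp => ?_⟩
  · have := Real.continuous_negMulLog
    fun_prop
  · rw [cmi, condEntropy_eq, condEntropy_eq]
    · exact fun w => hp _
    · exact fun w => Finset.sum_nonneg fun y _ => hp _

theorem tendsto_empDist {Ω₀ Ω α : Type*} [MeasurableSpace Ω₀] [MeasurableSpace Ω]
    [MeasurableSpace α] [MeasurableSingletonClass α] {P : Measure Ω₀}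
    {μ : Measure Ω} [IsProbabilityMeasure μ] {V : Ω₀ → α} {W : ℕ → Ω → α}
    (hind : iIndepFun W μ) (hid : ∀ i, IdentDistrib (W i) V μ P) (a : α) :
    ∀ᵐ ω ∂μ, Tendsto (fun n : ℕ => empDist (fun i : Fin n => W i ω) a) atTop (𝓝 (law P V a)) := by
  classical
  let f : α → ℝ := Set.indicator {a} 1
  have hf : Measurable f := measurable_one.indicator (measurableSet_singleton a)
  have hint : Integrable (f ∘ W 0) μ := by
    refine Integrable.of_bound (hf.comp_aemeasurable (hid 0).aemeasurable_fst).aestronglyMeasurable 1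
      (ae_of_all _ fun ω => ?_)
    simp only [f, Function.comp_apply, Set.indicator]
    split_ifs <;> simp
  have hlaw : ∫ ω, f (W 0 ω) ∂μ = law P V a := by
    refine ((hid 0).comp hf).integral_eq.trans ?_
    have hV := (hid 0).aemeasurable_snd
    change ∫ ω, f (V ω) ∂P = _
    rw [← integral_map hV hf.aestronglyMeasurable, integral_indicator_one (measurableSet_singleton a),
      law, map_measureReal_apply_of_aemeasurable hV (measurableSet_singleton a)]
  have h := strong_law_ae_real (fun i => f ∘ W i) hint
    (fun i j hij => (hind.indepFun hij).comp hf hf)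
    (fun i => ((hid i).trans (hid 0).symm).comp hf)
  filter_upwards [h] with ω hω
  rw [← hlaw]
  refine hω.congr fun n => ?_
  rw [empDist, count_eq_sum, ← Fin.sum_univ_eq_sum_range (fun i => (f ∘ W i) ω)]
  congr 1

theorem sampleSciQ_eq {Ω X Y Z : Type*} [Fintype X] [Fintype Y] [Fintype Z]
    (W : ℕ → Ω → X × Y × Z) (n : ℕ) (ω : Ω) :
    sampleSciQ W n ω = n * cmi (empDist fun i : Fin n => W i ω) +
      (regretQ n X Z - regretQ n X (Z × Y)) := by
  rw [sampleSciQ, sciQ_eq]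

theorem aestronglyMeasurable_sampleSciQ {Ω X Y Z : Type*} [Fintype X] [Fintype Y] [Fintype Z]
    [MeasurableSpace X] [MeasurableSpace Y] [MeasurableSpace Z] [MeasurableSingletonClass X]
    [MeasurableSingletonClass Y] [MeasurableSingletonClass Z] [MeasurableSpace Ω] {μ : Measure Ω}
    {W : ℕ → Ω → X × Y × Z} (hW : ∀ i, AEMeasurable (W i) μ) (n : ℕ) :
    AEStronglyMeasurable (sampleSciQ W n) μ := by
  let F : (Fin n → X × Y × Z) → ℝ := fun s =>
    sciQ (fun i => (s i).1) (fun i => (s i).2.1) fun i => (s i).2.2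
  have hF : Measurable F := measurable_of_finite F
  exact (hF.comp_aemeasurable
    (aemeasurable_pi_lambda (fun ω (i : Fin n) => W i ω) fun i => hW i)).aestronglyMeasurable

theorem exists_abs_cmi_empDist_le (X Y Z : Type*) [Fintype X] [Fintype Y] [Fintype Z] :
    ∃ C, ∀ (n : ℕ) (s : Fin n → X × Y × Z), |cmi (empDist s)| ≤ C := by
  obtain ⟨g, hg, hcmi⟩ := exists_continuous_eq_cmi X Y Z
  obtain ⟨C, hC⟩ := (isCompact_Icc (a := (0 : X × Y × Z → ℝ)) (b := 1)).exists_bound_of_continuousOn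
    hg.continuousOn
  refine ⟨C, fun n s => ?_⟩
  rw [hcmi _ (empDist_nonneg s)]
  exact hC _ ⟨empDist_nonneg s, empDist_le_one s⟩

theorem tendsto_integral_and_sq_of_bounded {Ω : Type*} [MeasurableSpace Ω] {μ : Measure Ω}
    [IsProbabilityMeasure μ] {F : ℕ → Ω → ℝ} {B c : ℝ} (hF : ∀ n, AEStronglyMeasurable (F n) μ)
    (hB : ∀ n ω, |F n ω| ≤ B) (hlim : ∀ᵐ ω ∂μ, Tendsto (fun n => F n ω) atTop (𝓝 c)) :
    Tendsto (fun n => ∫ ω, F n ω ∂μ) atTop (𝓝 c) ∧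
      Tendsto (fun n => ∫ ω, (F n ω - c) ^ 2 ∂μ) atTop (𝓝 0) := by
  constructor
  · have := tendsto_integral_of_dominated_convergence (fun _ => B) hF (integrable_const B)
      (fun n => ae_of_all _ (hB n)) hlim
    simpa using this
  · have := tendsto_integral_of_dominated_convergence (F := fun n ω => (F n ω - c) ^ 2)
      (f := fun _ => (0 : ℝ)) (μ := μ) (fun _ => (B + |c|) ^ 2)
      (fun n => ((hF n).sub aestronglyMeasurable_const).pow 2) (integrable_const _)
      (fun n => ae_of_all _ fun ω => ?_) ?_
    · simpa using this
    · rw [norm_pow, Real.norm_eq_abs]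
      exact pow_le_pow_left₀ (abs_nonneg _)
        ((abs_sub _ _).trans (add_le_add_left (hB n ω) _)) 2
    · filter_upwards [hlim] with ω hω
      simpa using (hω.sub_const c).pow 2

end QNML

theorem mainTheorem7 {𝒳 : Type*} {𝒴 : Type*} {𝒵 : Type*}
    [Fintype 𝒳] [Fintype 𝒴] [Fintype 𝒵] [Nonempty 𝒳] [Nonempty 𝒴] [Nonempty 𝒵]
    [MeasurableSpace 𝒳] [MeasurableSpace 𝒴] [MeasurableSpace 𝒵]
    [MeasurableSingletonClass 𝒳] [MeasurableSingletonClass 𝒴] [MeasurableSingletonClass 𝒵] :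
    -- monotonicity of the regret
    (∀ n : ℕ, QNML.regretQ n 𝒳 𝒵 ≤ QNML.regretQ n 𝒳 (𝒵 × 𝒴)) ∧
    -- conditional independence in the data is always recognized
    (∀ (n : ℕ) (x : Fin n → 𝒳) (y : Fin n → 𝒴) (z : Fin n → 𝒵),
      QNML.CondIndep (QNML.empDist fun i => (x i, y i, z i)) → QNML.sciQ x y z ≤ 0) ∧
    -- asymptotic unbiasedness and L² consistency for i.i.d. samples `W i` of `(X, Y, Z)`
    (∀ {Ω₀ : Type*} [MeasurableSpace Ω₀] (P : Measure Ω₀) [IsProbabilityMeasure P]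
      (X : Ω₀ → 𝒳) (Y : Ω₀ → 𝒴) (Z : Ω₀ → 𝒵)
      {Ω : Type*} [MeasurableSpace Ω] (μ : Measure Ω) [IsProbabilityMeasure μ]
      (W : ℕ → Ω → 𝒳 × 𝒴 × 𝒵),
      iIndepFun W μ →
      (∀ i, IdentDistrib (W i) (fun ω => (X ω, Y ω, Z ω)) μ P) →
      (∀ n, MemLp (QNML.sampleSciQ W n) 2 μ) ∧
      Tendsto (fun n : ℕ => ∫ ω, (1 / (n : ℝ)) * QNML.sampleSciQ W n ω ∂μ) atTop
        (𝓝 (QNML.cmi (QNML.law P fun ω => (X ω, Y ω, Z ω)))) ∧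
      Tendsto (fun n : ℕ => ∫ ω, ((1 / (n : ℝ)) * QNML.sampleSciQ W n ω -
          QNML.cmi (QNML.law P fun ω => (X ω, Y ω, Z ω))) ^ 2 ∂μ) atTop (𝓝 0)) := by
  refine ⟨fun n => QNML.regretQ_le_regretQ_prod n 𝒳 𝒴 𝒵, fun n x y z h => ?_, ?_⟩
  · have h' : QNML.cmi (QNML.empDist fun i => (x i, y i, z i)) = 0 := h
    rw [QNML.sciQ_eq, h', mul_zero, zero_add, sub_nonpos]
    exact QNML.regretQ_le_regretQ_prod n 𝒳 𝒴 𝒵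
  · intro Ω₀ _ P _ X Y Z Ω _ μ _ W hind hid
    have hmeas := QNML.aestronglyMeasurable_sampleSciQ fun i => (hid i).aemeasurable_fst
    obtain ⟨C, hC⟩ := QNML.exists_abs_cmi_empDist_le 𝒳 𝒴 𝒵
    set r : ℕ → ℝ := fun n => QNML.regretQ n 𝒳 𝒵 - QNML.regretQ n 𝒳 (𝒵 × 𝒴) with hr
    have hr0 : Tendsto (fun n : ℕ => r n / n) atTop (𝓝 0) := by
      simpa [hr, sub_div] using
        (QNML.tendsto_regretQ_div 𝒳 𝒵).sub (QNML.tendsto_regretQ_div 𝒳 (𝒵 × 𝒴))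
    obtain ⟨D, hD⟩ := hr0.abs.bddAbove_range
    have hD' (n : ℕ) : |r n / n| ≤ D := hD ⟨n, rfl⟩
    have heq {n : ℕ} (hn : n ≠ 0) (ω : Ω) : 1 / (n : ℝ) * QNML.sampleSciQ W n ω =
        QNML.cmi (QNML.empDist fun i : Fin n => W i ω) + r n / n := by
      rw [QNML.sampleSciQ_eq]
      field_simp
      rfl
    refine ⟨fun n => MemLp.of_bound (hmeas n) (n * C + |r n|) (ae_of_all _ fun ω => ?_), ?_⟩
    · rw [QNML.sampleSciQ_eq, Real.norm_eq_abs]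
      refine (abs_add_le _ _).trans (add_le_add_left ?_ _)
      rw [abs_mul, Nat.abs_cast]
      exact mul_le_mul_of_nonneg_left (hC n _) n.cast_nonneg
    · refine QNML.tendsto_integral_and_sq_of_bounded (B := C + D)
        (fun n => (hmeas n).const_mul _) (fun n ω => ?_) ?_
      · rcases eq_or_ne n 0 with rfl | hn
        · have h1 := (abs_nonneg _).trans (hC 0 fun i => W i ω)
          have h2 := (abs_nonneg _).trans (hD' 0)
          simpa using add_nonneg h1 h2
        · rw [heq hn]
          exact (abs_add_le _ _).trans (add_le_add (hC n _) (hD' n))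
      · obtain ⟨g, hg, hcmi⟩ := QNML.exists_continuous_eq_cmi 𝒳 𝒴 𝒵
        filter_upwards [ae_all_iff.2 fun a => QNML.tendsto_empDist hind hid a] with ω hω
        rw [hcmi (QNML.law P _) fun w => measureReal_nonneg]
        have h := ((hg.tendsto _).comp (tendsto_pi_nhds.2 hω)).add hr0
        rw [add_zero] at h
        refine h.congr' ?_
        filter_upwards [eventually_ne_atTop 0] with n hn
        rw [heq hn, hcmi _ (QNML.empDist_nonneg _)]
        rfl
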